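/- Let $(\Omega,\mathcal F,\mathbb P)$ be a probability space, let $X\in L^2(\Omega)$ and $X_\ell\in L^2(\Omega)$, $\ell\in\mathbb N_0=\{0,1,2,\dots\}$, be real random variables, and put $X_{-1}:=0$, $\Delta_\ell X:=X_\ell-X_{\ell-1}$, $V_\ell:=\mathrm{Var}(\Delta_\ell X)$. Let $C_\ell\ge 0$ denote the cost of one sample of $\Delta_\ell X$. Suppose that there are constants $\alpha,\beta,\gamma,c_\alpha>0$ with $\min(\beta,\gamma)\le 2\alpha$, and constants $K>0$ and $k_2>k_1>0$, such that for all $\ell\in\mathbb N_0$ $$|\mathbb E[X-X_\ell]|\le c_\alpha e^{-\alpha\ell},\qquad V_\ell< K e^{-\beta\ell},\qquad k_1e^{\gamma\ell}<C_\ell<k_2e^{\gamma\ell}.$$ Let $\{\Delta_\ell X^i\}_{\ell\in\mathbb N_0,\,i\in\mathbb N}$ be independent random variables on $\Omega$ such that each $\Delta_\ell X^i$ has the law of $\Delta_\ell X$. For $\epsilon>0$ let $$L(\epsilon)=\max\Big(\Big\lceil\tfrac{\log(c_\alpha\epsilon^{-1})}{\alpha}\Big\rceil,1\Big),\qquad M_\ell(\epsilon)=\max\Big(\Big\lceil\epsilon^{-2}\sqrt{\tfrac{V_\ell}{C_\ell}}\sum_{j=0}^{L(\epsilon)}\sqrt{C_jV_j}\Big\rceil,1\Big),$$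 $$\mathcal A(\epsilon)=\sum_{\ell=0}^{L(\epsilon)}\sum_{i=1}^{M_\ell(\epsilon)}\frac{\Delta_\ell X^i}{M_\ell(\epsilon)},\qquad n(\epsilon)=\sum_{\ell=0}^{L(\epsilon)}M_\ell(\epsilon),$$ and let $Y_{\epsilon 1},\dots,Y_{\epsilon n(\epsilon)}$ be the random variables $$\frac{\Delta_\ell X^i-\mathbb E[\Delta_\ell X]}{\sqrt{\mathrm{Var}(\mathcal A(\epsilon))}\,M_\ell(\epsilon)},\qquad 0\le\ell\le L(\epsilon),\ 1\le i\le M_\ell(\epsilon),$$ listed level by level. If $\beta>\gamma$ and $V_0>0$, then the normalized multilevel Monte Carlo estimator satisfies the extended CLT condition, that is, $$\frac{\mathcal A(\epsilon)-\mathbb E[X_{L(\epsilon)}]}{\sqrt{\mathrm{Var}(\mathcal A(\epsilon))}}=\sum_{m=1}^{n(\epsilon)}Y_{\epsilon m}\ \text{ for every }\epsilon>0,$$ $$\sum_{m=1}^{n(\epsilon)}Y_{\epsilon m}\xrightarrow{\ \mathrm d\ }\mathcal N(0,1)\ \text{ as }\epsilon\downarrow0,\qquad\text{and}\qquad\lim_{\epsilon\downarrow0}\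 \max_{1\le m\le n(\epsilon)}\mathbb E\big[Y_{\epsilon m}^2\big]=0.$$ -/

import Mathlib

open MeasureTheory ProbabilityTheory Filter Topology

namespace MLMC

/-- `f(ℓ) = 𝒪(y(ℓ))`, with a constant that is uniform over all `ℓ ∈ ℕ₀`. -/
def IsBigOAll (f y : ℕ → ℝ) : Prop :=
  ∃ K : ℝ, 0 < K ∧ ∀ ℓ : ℕ, |f ℓ| < K * |y ℓ|

/-- `f(ℓ) = Θ(y(ℓ))`, with constants that are uniform over all `ℓ ∈ ℕ₀`. -/
def IsThetaAll (f y : ℕ → ℝ) : Prop :=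
  ∃ k K : ℝ, 0 < k ∧ k < K ∧ ∀ ℓ : ℕ, k * |y ℓ| < |f ℓ| ∧ |f ℓ| < K * |y ℓ|

section Estimator

variable {Ω : Type*} [MeasurableSpace Ω]

/-- The level difference `Δ_ℓ X = X_ℓ - X_{ℓ-1}`, with the convention `X_{-1} = 0`. -/
def diff (Xs : ℕ → Ω → ℝ) : ℕ → Ω → ℝ
  | 0 => Xs 0
  | ℓ + 1 => fun ω => Xs (ℓ + 1) ω - Xs ℓ ω

/-- `V_ℓ = Var(Δ_ℓ X)`. -/
noncomputable def levelVar (μ : Measure Ω) (Xs : ℕ → Ω → ℝ) (ℓ : ℕ) : ℝ :=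
  variance (diff Xs ℓ) μ

/-- The standing rate assumptions on the square integrable approximations `X_ℓ` of the square
integrable random variable `X`. The number `C ℓ` is the cost of one sample of `Δ_ℓ X`. -/
structure RateAssumption (μ : Measure Ω) (X : Ω → ℝ) (Xs : ℕ → Ω → ℝ) (C : ℕ → ℝ)
    (α β γ cα : ℝ) : Prop where
  memLp_limit : MemLp X 2 μ
  memLp_level : ∀ ℓ, MemLp (Xs ℓ) 2 μ
  alpha_pos : 0 < α
  beta_pos : 0 < β
  gamma_pos : 0 < γ
  const_pos : 0 < cα
  min_le : min β γ ≤ 2 * α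
  bias : ∀ ℓ : ℕ, |∫ ω, (X ω - Xs ℓ ω) ∂μ| ≤ cα * Real.exp (-α * ℓ)
  var_rate : IsBigOAll (levelVar μ Xs) (fun ℓ => Real.exp (-β * ℓ))
  cost_nonneg : ∀ ℓ, 0 ≤ C ℓ
  cost_rate : IsThetaAll C (fun ℓ => Real.exp (γ * ℓ))

/-- `D ℓ i`, for `i = 0, 1, 2, …`, are the samples of `Δ_ℓ X`: the whole family, over all levels
and all sample indices, is independent, and each `D ℓ i` has the law of `Δ_ℓ X`. -/
structure IsSampling (μ : Measure Ω) (Xs : ℕ → Ω → ℝ) (D : ℕ → ℕ → Ω → ℝ) : Prop where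
  indep : iIndepFun (fun p : ℕ × ℕ => D p.1 p.2) μ
  identDistrib : ∀ ℓ i, IdentDistrib (D ℓ i) (diff Xs ℓ) μ μ

/-- The number of levels `L(ε) = max(⌈log(c_α ε⁻¹) / α⌉, 1)`. -/
noncomputable def numLevels (α cα ε : ℝ) : ℕ :=
  max ⌈Real.log (cα * ε⁻¹) / α⌉₊ 1

/-- The number of samples on level `ℓ`,
`M_ℓ(ε) = max(⌈ε⁻² √(V_ℓ / C_ℓ) ∑_{j ≤ L(ε)} √(C_j V_j)⌉, 1)`. -/
noncomputable def numSamples (μ : Measure Ω) (Xs : ℕ → Ω → ℝ) (C : ℕ → ℝ) (α cα ε : ℝ)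
    (ℓ : ℕ) : ℕ :=
  max ⌈(ε ^ 2)⁻¹ * √(levelVar μ Xs ℓ / C ℓ) *
    ∑ j ∈ Finset.range (numLevels α cα ε + 1), √(C j * levelVar μ Xs j)⌉₊ 1

/-- The MLMC estimator `∑_{ℓ ≤ L(ε)} ∑_{i < M_ℓ(ε)} Δ_ℓ X^i / M_ℓ(ε)`. -/
noncomputable def estimator (μ : Measure Ω) (Xs : ℕ → Ω → ℝ) (D : ℕ → ℕ → Ω → ℝ) (C : ℕ → ℝ)
    (α cα ε : ℝ) (ω : Ω) : ℝ :=
  ∑ ℓ ∈ Finset.range (numLevels α cα ε + 1),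
    ∑ i ∈ Finset.range (numSamples μ Xs C α cα ε ℓ),
      D ℓ i ω / (numSamples μ Xs C α cα ε ℓ : ℝ)

/-- The normalized MLMC estimator `(A(ε) - E[X_{L(ε)}]) / √Var(A(ε))`. -/
noncomputable def normalizedEstimator (μ : Measure Ω) (Xs : ℕ → Ω → ℝ) (D : ℕ → ℕ → Ω → ℝ)
    (C : ℕ → ℝ) (α cα ε : ℝ) (ω : Ω) : ℝ :=
  (estimator μ Xs D C α cα ε ω - ∫ ω', Xs (numLevels α cα ε) ω' ∂μ) /
    √(variance (estimator μ Xs D C α cα ε) μ)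

/-- The total number of samples `n(ε) = ∑_{ℓ ≤ L(ε)} M_ℓ(ε)`. -/
noncomputable def totalSamples (μ : Measure Ω) (Xs : ℕ → Ω → ℝ) (C : ℕ → ℝ) (α cα ε : ℝ) : ℕ :=
  ∑ ℓ : Fin (numLevels α cα ε + 1), numSamples μ Xs C α cα ε ℓ

/-- The generalized triangular array of the normalized MLMC estimator. The `n(ε)` samples are
listed level by level, and the sample `i` of level `ℓ` gives the entry
`(Δ_ℓ X^i - E[Δ_ℓ X]) / (√Var(A(ε)) M_ℓ(ε))`. -/
noncomputable def array (μ : Measure Ω) (Xs : ℕ → Ω → ℝ) (D : ℕ → ℕ → Ω → ℝ) (C : ℕ → ℝ)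
    (α cα ε : ℝ) (m : Fin (totalSamples μ Xs C α cα ε)) (ω : Ω) : ℝ :=
  let p : (ℓ : Fin (numLevels α cα ε + 1)) × Fin (numSamples μ Xs C α cα ε ℓ) :=
    finSigmaFinEquiv.symm m
  (D p.1 p.2 ω - ∫ ω', diff Xs p.1 ω' ∂μ) /
    (√(variance (estimator μ Xs D C α cα ε) μ) * (numSamples μ Xs C α cα ε p.1 : ℝ))

/-- The extended CLT condition for a generalized triangular array `Y_{ε m}`, `m < n(ε)`: as
`ε ↓ 0`, the row sums converge in distribution to `N(0, 1)`, and the maximum over the row of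
`E[Y_{ε m}²]` tends to `0`. -/
def ExtendedCLT (μ : Measure Ω) [IsProbabilityMeasure μ] (n : ℝ → ℕ)
    (Y : (ε : ℝ) → Fin (n ε) → Ω → ℝ) : Prop :=
  TendstoInDistribution (fun ε ω => ∑ m, Y ε m ω) (𝓝[>] (0 : ℝ)) (id : ℝ → ℝ)
      (fun _ => μ) (gaussianReal 0 1) ∧
    Tendsto (fun ε => ⨆ m : Fin (n ε), ∫ ω, (Y ε m ω) ^ 2 ∂μ) (𝓝[>] (0 : ℝ)) (𝓝 0)

end Estimator

end MLMC

namespace MLMC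

/-- A dominated sum over growing initial segments tends to zero if each term does. -/
lemma tendsto_sum_range_zero_of_dominated {ι : Type*} {F : Filter ι} {f : ι → ℕ → ℝ} (N : ι → ℕ)
    {b : ℕ → ℝ} (hb : Summable b) (hf : ∀ᶠ i in F, ∀ ℓ, |f i ℓ| ≤ b ℓ)
    (h0 : ∀ ℓ, Tendsto (fun i => f i ℓ) F (𝓝 0)) :
    Tendsto (fun i => ∑ ℓ ∈ Finset.range (N i), f i ℓ) F (𝓝 0) := by
  have key : Tendsto (fun i => ∑' ℓ, |f i ℓ|) F (𝓝 0) := by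
    have := tendsto_tsum_of_dominated_convergence (𝓕 := F) (f := fun i ℓ => |f i ℓ|)
      (g := fun _ => (0 : ℝ)) hb (fun ℓ => by simpa using (h0 ℓ).abs)
      (by filter_upwards [hf] with i hi ℓ using by simpa using hi ℓ)
    simpa using this
  refine squeeze_zero_norm' ?_ key
  filter_upwards [hf] with i hi
  have hs : Summable fun ℓ => |f i ℓ| := Summable.of_nonneg_of_le (fun _ => abs_nonneg _) hi hb
  exact (norm_sum_le _ _).trans (hs.sum_le_tsum _ fun _ _ => abs_nonneg _)

lemma norm_prod_sub_prod_le {ι : Type*} (s : Finset ι) (a b : ι → ℂ)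
    (ha : ∀ i ∈ s, ‖a i‖ ≤ 1) (hb : ∀ i ∈ s, ‖b i‖ ≤ 1) :
    ‖∏ i ∈ s, a i - ∏ i ∈ s, b i‖ ≤ ∑ i ∈ s, ‖a i - b i‖ := by
  induction s using Finset.cons_induction with
  | empty => simp
  | cons j s hj ih =>
    simp only [Finset.mem_cons, forall_eq_or_imp] at ha hb
    rw [Finset.prod_cons, Finset.prod_cons, Finset.sum_cons]
    have hprod : ‖∏ i ∈ s, b i‖ ≤ 1 := by
      rw [norm_prod]
      exact Finset.prod_le_one (fun _ _ => norm_nonneg _) hb.2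
    calc ‖a j * ∏ i ∈ s, a i - b j * ∏ i ∈ s, b i‖
        = ‖(a j - b j) * ∏ i ∈ s, b i + a j * (∏ i ∈ s, a i - ∏ i ∈ s, b i)‖ := by
          congr 1; ring
      _ ≤ ‖a j - b j‖ * ‖∏ i ∈ s, b i‖ + ‖a j‖ * ‖∏ i ∈ s, a i - ∏ i ∈ s, b i‖ := by
          simpa only [norm_mul] using norm_add_le ((a j - b j) * ∏ i ∈ s, b i)
            (a j * (∏ i ∈ s, a i - ∏ i ∈ s, b i))
      _ ≤ ‖a j - b j‖ * 1 + 1 * ∑ i ∈ s, ‖a i - b i‖ := by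
          gcongr
          exacts [ha.1, ih ha.2 hb.2]
      _ = _ := by ring

lemma norm_cexp_mul_I_sub_one_sub_le (x : ℝ) :
    ‖Complex.exp (x * Complex.I) - 1 - x * Complex.I‖ ≤ 3 * x ^ 2 := by
  have hx : ‖(x : ℂ) * Complex.I‖ = |x| := by simp
  rcases le_total |x| 1 with h | h
  · have := Complex.norm_exp_sub_one_sub_id_le (x := x * Complex.I) (by rwa [hx])
    rw [hx, sq_abs] at this
    nlinarith [sq_nonneg x]
  · have h1 := norm_sub_le (Complex.exp (x * Complex.I) - 1) (x * Complex.I)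
    have h2 := norm_sub_le (Complex.exp (x * Complex.I)) 1
    rw [Complex.norm_exp_ofReal_mul_I, norm_one] at h2
    rw [hx] at h1
    nlinarith [sq_abs x]

section CharFun

variable {ν ρ : Measure ℝ} [IsProbabilityMeasure ν] [IsProbabilityMeasure ρ]

lemma norm_charFun_sub_one_le (h2 : MemLp id 2 ν) (h0 : ∫ x, x ∂ν = 0) (t : ℝ) :
    ‖charFun ν t - 1‖ ≤ 3 * (∫ x, x ^ 2 ∂ν) * t ^ 2 := by
  have hsq : Integrable (fun x : ℝ => x ^ 2) ν := h2.integrable_sq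
  have hint : Integrable (fun x : ℝ => x) ν := h2.integrable (by norm_num)
  have hexp : Integrable (fun x : ℝ => Complex.exp (t * x * Complex.I)) ν := by
    refine Integrable.of_bound (C := 1) (by fun_prop) (ae_of_all _ fun x => ?_)
    rw [← Complex.ofReal_mul, Complex.norm_exp_ofReal_mul_I]
  have hlin : Integrable (fun x : ℝ => (t : ℂ) * x * Complex.I) ν :=
    (hint.ofReal.const_mul _).mul_const _
  have hzero : ∫ x : ℝ, (t : ℂ) * x * Complex.I ∂ν = 0 := by
    rw [integral_mul_const, integral_const_mul, integral_complex_ofReal, h0]; simp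
  have : charFun ν t - 1
      = ∫ x : ℝ, (Complex.exp (t * x * Complex.I) - 1 - t * x * Complex.I) ∂ν := by
    rw [integral_sub (f := fun x : ℝ => Complex.exp (t * x * Complex.I) - 1)
        (hexp.sub (integrable_const 1)) hlin, integral_sub hexp (integrable_const 1),
      hzero, charFun_apply_real]
    simp
  rw [this]
  calc _ ≤ ∫ x : ℝ, 3 * t ^ 2 * x ^ 2 ∂ν := by
        refine norm_integral_le_of_norm_le (hsq.const_mul _) (ae_of_all _ fun x => ?_)
        have := norm_cexp_mul_I_sub_one_sub_le (t * x)
        push_cast at this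
        linarith [mul_pow t x 2]
    _ = _ := by rw [integral_const_mul]; ring

lemma charFun_isLittleO_taylor (h2 : MemLp id 2 ν) (h0 : ∫ x, x ∂ν = 0) :
    (fun t : ℝ => charFun ν t - (1 - ((∫ x, x ^ 2 ∂ν : ℝ) : ℂ) * t ^ 2 / 2))
      =o[𝓝 0] fun t : ℝ => t ^ 2 := by
  have h := taylor_isLittleO_univ (x₀ := 0) (contDiff_charFun (n := 2) h2)
  have hT (t : ℝ) := taylorWithinEval_charFun_two_zero (P := ν) (X := id) aemeasurable_id
    (by simpa using h2) t
  simp only [Measure.map_id] at hT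
  simpa only [hT, id, Pi.pow_apply, h0, Complex.ofReal_zero, zero_mul, add_zero, sub_zero]
    using h

/-- Centered laws with the same variance have characteristic functions that agree to second
order at zero. -/
lemma charFun_sub_charFun_isLittleO (h2 : MemLp id 2 ν) (h0 : ∫ x, x ∂ν = 0)
    (h2' : MemLp id 2 ρ) (h0' : ∫ x, x ∂ρ = 0) (hv : ∫ x, x ^ 2 ∂ν = ∫ x, x ^ 2 ∂ρ) :
    (fun t : ℝ => charFun ν t - charFun ρ t) =o[𝓝 0] fun t : ℝ => t ^ 2 := by
  have h := (charFun_isLittleO_taylor h2 h0).sub (charFun_isLittleO_taylor h2' h0')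
  rw [hv] at h
  simpa using h

lemma norm_charFun_sub_charFun_le (h2 : MemLp id 2 ν) (h0 : ∫ x, x ∂ν = 0)
    (h2' : MemLp id 2 ρ) (h0' : ∫ x, x ∂ρ = 0) (hv : ∫ x, x ^ 2 ∂ν = ∫ x, x ^ 2 ∂ρ) (t : ℝ) :
    ‖charFun ν t - charFun ρ t‖ ≤ 6 * (∫ x, x ^ 2 ∂ν) * t ^ 2 := by
  have h1 := norm_charFun_sub_one_le h2 h0 t
  have h1' := norm_charFun_sub_one_le h2' h0' t
  rw [← hv] at h1'
  have := norm_sub_le (charFun ν t - 1) (charFun ρ t - 1)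
  rw [sub_sub_sub_cancel_right] at this
  linarith

end CharFun

section Estimator

variable {Ω : Type*} [MeasurableSpace Ω] {μ : Measure Ω} {Xs : ℕ → Ω → ℝ} {D : ℕ → ℕ → Ω → ℝ}

lemma memLp_diff (hX : ∀ ℓ, MemLp (Xs ℓ) 2 μ) (ℓ : ℕ) : MemLp (diff Xs ℓ) 2 μ := by
  cases ℓ with
  | zero => exact hX 0
  | succ ℓ => exact (hX (ℓ + 1)).sub (hX ℓ)

lemma sum_integral_diff [IsFiniteMeasure μ] (hX : ∀ ℓ, MemLp (Xs ℓ) 2 μ) (L : ℕ) :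
    ∑ ℓ ∈ Finset.range (L + 1), ∫ ω, diff Xs ℓ ω ∂μ = ∫ ω, Xs L ω ∂μ := by
  have hint ℓ : Integrable (Xs ℓ) μ := (hX ℓ).integrable (by norm_num)
  induction L with
  | zero => simp [diff]
  | succ L ih =>
    rw [Finset.sum_range_succ, ih]
    simp only [diff]
    rw [integral_sub (hint _) (hint _)]
    ring

lemma levelVar_nonneg (ℓ : ℕ) : 0 ≤ levelVar μ Xs ℓ := variance_nonneg _ _

lemma numSamples_pos (C : ℕ → ℝ) (α cα ε : ℝ) (ℓ : ℕ) : 0 < numSamples μ Xs C α cα ε ℓ :=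
  lt_of_lt_of_le one_pos (le_max_right _ _)

lemma sum_array (C : ℕ → ℝ) (α cα ε : ℝ) (ω : Ω) :
    ∑ m, array μ Xs D C α cα ε m ω =
      ∑ ℓ ∈ Finset.range (numLevels α cα ε + 1),
        ∑ i ∈ Finset.range (numSamples μ Xs C α cα ε ℓ),
          (D ℓ i ω - ∫ ω', diff Xs ℓ ω' ∂μ) /
            (√(variance (estimator μ Xs D C α cα ε) μ) * (numSamples μ Xs C α cα ε ℓ : ℝ)) := by
  simp only [Finset.sum_range]
  exact (Equiv.sum_comp finSigmaFinEquiv.symm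
    (fun p : (ℓ : Fin (numLevels α cα ε + 1)) × Fin (numSamples μ Xs C α cα ε ℓ) =>
      (D p.1 p.2 ω - ∫ ω', diff Xs p.1 ω' ∂μ) /
        (√(variance (estimator μ Xs D C α cα ε) μ) * (numSamples μ Xs C α cα ε p.1 : ℝ)))).trans
    (Fintype.sum_sigma _)

lemma normalizedEstimator_eq_sum_array [IsFiniteMeasure μ] (hX : ∀ ℓ, MemLp (Xs ℓ) 2 μ)
    (C : ℕ → ℝ) (α cα ε : ℝ) (ω : Ω) :
    normalizedEstimator μ Xs D C α cα ε ω = ∑ m, array μ Xs D C α cα ε m ω := by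
  rw [sum_array, normalizedEstimator, estimator, ← sum_integral_diff hX, ← Finset.sum_sub_distrib,
    Finset.sum_div]
  refine Finset.sum_congr rfl fun ℓ _ => ?_
  have hM : (numSamples μ Xs C α cα ε ℓ : ℝ) ≠ 0 :=
    Nat.cast_ne_zero.2 (numSamples_pos C α cα ε ℓ).ne'
  rw [← Finset.sum_div, ← Finset.sum_div, Finset.sum_sub_distrib, Finset.sum_const,
    Finset.card_range, nsmul_eq_mul, mul_comm (√_), ← div_div]
  congr 1
  rw [sub_div, mul_div_cancel_left₀ _ hM]

/-- The samples that the estimator uses when level `ℓ < N` receives `M ℓ` of them. -/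
abbrev sampleIndices (N : ℕ) (M : ℕ → ℕ) : Finset ((_ : ℕ) × ℕ) :=
  (Finset.range N).sigma fun ℓ => Finset.range (M ℓ)

lemma IsSampling.iIndepFun_sigma (hD : IsSampling μ Xs D) :
    iIndepFun (fun p : (_ : ℕ) × ℕ => D p.1 p.2) μ :=
  hD.indep.precomp (g := fun p : (_ : ℕ) × ℕ => (p.1, p.2)) fun p q h => by
    cases p; cases q; simp_all

lemma IsSampling.memLp (hD : IsSampling μ Xs D) (hX : ∀ ℓ, MemLp (Xs ℓ) 2 μ) (ℓ i : ℕ) :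
    MemLp (D ℓ i) 2 μ :=
  (hD.identDistrib ℓ i).memLp_iff.2 (memLp_diff hX ℓ)

lemma IsSampling.variance_estimator [IsProbabilityMeasure μ] (hD : IsSampling μ Xs D)
    (hX : ∀ ℓ, MemLp (Xs ℓ) 2 μ) (C : ℕ → ℝ) (α cα ε : ℝ) :
    variance (estimator μ Xs D C α cα ε) μ =
      ∑ ℓ ∈ Finset.range (numLevels α cα ε + 1),
        levelVar μ Xs ℓ / (numSamples μ Xs C α cα ε ℓ : ℝ) := by
  set M := numSamples μ Xs C α cα ε
  have h : estimator μ Xs D C α cα ε = ∑ p ∈ sampleIndices (numLevels α cα ε + 1) M,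
      fun ω => (M p.1 : ℝ)⁻¹ * D p.1 p.2 ω := by
    ext ω
    rw [Finset.sum_apply, Finset.sum_sigma, estimator]
    simp only [div_eq_inv_mul, M]
  rw [h, IndepFun.variance_sum, Finset.sum_sigma]
  · refine Finset.sum_congr rfl fun ℓ _ => ?_
    have hM : (M ℓ : ℝ) ≠ 0 := Nat.cast_ne_zero.2 (numSamples_pos C α cα ε ℓ).ne'
    simp only [variance_const_mul, (hD.identDistrib ℓ _).variance_eq]
    rw [Finset.sum_const, Finset.card_range, nsmul_eq_mul, levelVar]
    field_simp
  · exact fun p _ => (hD.memLp hX p.1 p.2).const_mul _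
  · intro p _ q _ hpq
    exact (hD.iIndepFun_sigma.indepFun hpq).comp (φ := fun x => (M p.1 : ℝ)⁻¹ * x)
      (ψ := fun x => (M q.1 : ℝ)⁻¹ * x) (by fun_prop) (by fun_prop)

/-- The law of the centered level difference `Δ_ℓ X - E[Δ_ℓ X]`. -/
noncomputable def centeredLaw (μ : Measure Ω) (Xs : ℕ → Ω → ℝ) (ℓ : ℕ) : Measure ℝ :=
  μ.map fun ω => diff Xs ℓ ω - ∫ ω', diff Xs ℓ ω' ∂μ

lemma aemeasurable_centered (hX : ∀ ℓ, MemLp (Xs ℓ) 2 μ) (ℓ : ℕ) :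
    AEMeasurable (fun ω => diff Xs ℓ ω - ∫ ω', diff Xs ℓ ω' ∂μ) μ :=
  (memLp_diff hX ℓ).aestronglyMeasurable.aemeasurable.sub_const _

lemma isProbabilityMeasure_centeredLaw [IsProbabilityMeasure μ]
    (hX : ∀ ℓ, MemLp (Xs ℓ) 2 μ) (ℓ : ℕ) :
    IsProbabilityMeasure (centeredLaw μ Xs ℓ) :=
  Measure.isProbabilityMeasure_map (aemeasurable_centered hX ℓ)

lemma memLp_id_centeredLaw [IsProbabilityMeasure μ] (hX : ∀ ℓ, MemLp (Xs ℓ) 2 μ) (ℓ : ℕ) :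
    MemLp id 2 (centeredLaw μ Xs ℓ) :=
  (memLp_map_measure_iff aestronglyMeasurable_id (aemeasurable_centered hX ℓ)).2
    ((memLp_diff hX ℓ).sub (memLp_const _))

lemma integral_centeredLaw [IsProbabilityMeasure μ] (hX : ∀ ℓ, MemLp (Xs ℓ) 2 μ) (ℓ : ℕ) :
    ∫ x, x ∂centeredLaw μ Xs ℓ = 0 := by
  rw [centeredLaw, integral_map (aemeasurable_centered hX ℓ) (by fun_prop),
    integral_sub ((memLp_diff hX ℓ).integrable (by norm_num)) (integrable_const _)]
  simp

lemma integral_sq_centeredLaw (hX : ∀ ℓ, MemLp (Xs ℓ) 2 μ) (ℓ : ℕ) :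
    ∫ x, x ^ 2 ∂centeredLaw μ Xs ℓ = levelVar μ Xs ℓ := by
  rw [centeredLaw, integral_map (aemeasurable_centered hX ℓ) (by fun_prop), levelVar,
    variance_eq_integral (memLp_diff hX ℓ).aestronglyMeasurable.aemeasurable]

lemma IsSampling.map_centered (hD : IsSampling μ Xs D) (ℓ i : ℕ) :
    μ.map (fun ω => D ℓ i ω - ∫ ω', diff Xs ℓ ω' ∂μ) = centeredLaw μ Xs ℓ :=
  ((hD.identDistrib ℓ i).comp (u := fun x => x - ∫ ω', diff Xs ℓ ω' ∂μ) (by fun_prop)).map_eq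

lemma IsSampling.integral_array_sq (hD : IsSampling μ Xs D) (C : ℕ → ℝ) (α cα ε : ℝ)
    (hX : ∀ ℓ, MemLp (Xs ℓ) 2 μ) (m : Fin (totalSamples μ Xs C α cα ε)) :
    ∃ ℓ ∈ Finset.range (numLevels α cα ε + 1), ∫ ω, array μ Xs D C α cα ε m ω ^ 2 ∂μ =
      levelVar μ Xs ℓ / (variance (estimator μ Xs D C α cα ε) μ *
        (numSamples μ Xs C α cα ε ℓ : ℝ) ^ 2) := by
  set p : (ℓ : Fin (numLevels α cα ε + 1)) × Fin (numSamples μ Xs C α cα ε ℓ) :=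
    finSigmaFinEquiv.symm m with hp
  refine ⟨p.1, Finset.mem_range.2 p.1.2, ?_⟩
  have hsq : ∫ ω, (D p.1 p.2 ω - ∫ ω', diff Xs p.1 ω' ∂μ) ^ 2 ∂μ = levelVar μ Xs p.1 := by
    rw [← integral_sq_centeredLaw hX, ← hD.map_centered p.1 p.2, integral_map]
    · exact (hD.memLp hX _ _).aestronglyMeasurable.aemeasurable.sub_const _
    · fun_prop
  have harr (ω : Ω) : array μ Xs D C α cα ε m ω = (D p.1 p.2 ω - ∫ ω', diff Xs p.1 ω' ∂μ) /
      (√(variance (estimator μ Xs D C α cα ε) μ) * (numSamples μ Xs C α cα ε p.1 : ℝ)) := rfl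
  simp only [harr, div_pow]
  rw [integral_div, hsq, mul_pow, Real.sq_sqrt (variance_nonneg _ _)]

lemma IsSampling.aemeasurable_sum_array (hD : IsSampling μ Xs D) (C : ℕ → ℝ) (α cα ε : ℝ) :
    AEMeasurable (fun ω => ∑ m, array μ Xs D C α cα ε m ω) μ := by
  simp only [sum_array]
  refine Finset.aemeasurable_fun_sum _ fun ℓ _ => Finset.aemeasurable_fun_sum _ fun i _ => ?_
  exact ((hD.identDistrib ℓ i).aemeasurable_fst.sub_const _).div_const _

lemma IsSampling.charFun_sum_array [IsProbabilityMeasure μ] (hD : IsSampling μ Xs D)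
    (C : ℕ → ℝ) (α cα ε t : ℝ) :
    charFun (μ.map fun ω => ∑ m, array μ Xs D C α cα ε m ω) t =
      ∏ p ∈ sampleIndices (numLevels α cα ε + 1) (numSamples μ Xs C α cα ε),
        charFun (centeredLaw μ Xs p.1) ((√(variance (estimator μ Xs D C α cα ε) μ) *
          (numSamples μ Xs C α cα ε p.1 : ℝ))⁻¹ * t) := by
  set M := numSamples μ Xs C α cα ε
  set σ := √(variance (estimator μ Xs D C α cα ε) μ)
  have hmeas (p : (_ : ℕ) × ℕ) :
      AEMeasurable (fun ω => D p.1 p.2 ω - ∫ ω', diff Xs p.1 ω' ∂μ) μ :=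
    (hD.identDistrib _ _).aemeasurable_fst.sub_const _
  have h : (fun ω => ∑ m, array μ Xs D C α cα ε m ω) =
      fun ω => ∑ p ∈ sampleIndices (numLevels α cα ε + 1) M,
        (σ * M p.1)⁻¹ * (D p.1 p.2 ω - ∫ ω', diff Xs p.1 ω' ∂μ) := by
    ext ω
    rw [sum_array, Finset.sum_sigma]
    simp only [div_eq_inv_mul, M, σ]
  have hind : iIndepFun (fun p : (_ : ℕ) × ℕ => fun ω =>
      (σ * M p.1)⁻¹ * (D p.1 p.2 ω - ∫ ω', diff Xs p.1 ω' ∂μ)) μ :=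
    hD.iIndepFun_sigma.comp (fun p x => (σ * M p.1)⁻¹ * (x - ∫ ω', diff Xs p.1 ω' ∂μ))
      fun p => by fun_prop
  rw [h, (hind.restrict _).charFun_map_fun_finsetSum_eq_prod
    (fun p _ => (hmeas p).const_mul _), Finset.prod_apply]
  refine Finset.prod_congr rfl fun p _ => ?_
  rw [charFun_map_mul_comp (hmeas p), hD.map_centered]

end Estimator

section Rates

variable {Ω : Type*} [MeasurableSpace Ω] {μ : Measure Ω} {X : Ω → ℝ} {Xs : ℕ → Ω → ℝ}
  {D : ℕ → ℕ → Ω → ℝ} {C : ℕ → ℝ} {α β γ cα : ℝ}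

lemma RateAssumption.cost_pos (h : RateAssumption μ X Xs C α β γ cα) (ℓ : ℕ) : 0 < C ℓ := by
  obtain ⟨k, K, hk, -, hC⟩ := h.cost_rate
  rw [← abs_of_nonneg (h.cost_nonneg ℓ)]
  exact (by positivity : 0 ≤ k * |Real.exp (γ * ℓ)|).trans_lt (hC ℓ).1

lemma RateAssumption.summable_sqrt_cost_mul_levelVar (h : RateAssumption μ X Xs C α β γ cα)
    (hβγ : γ < β) : Summable fun ℓ => √(C ℓ * levelVar μ Xs ℓ) := by
  obtain ⟨_, k, -, -, hC⟩ := h.cost_rate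
  obtain ⟨K, -, hV⟩ := h.var_rate
  have hgeom : Summable fun ℓ : ℕ => √(k * K) * Real.exp (-(β - γ) / 2) ^ ℓ :=
    (summable_geometric_of_lt_one (Real.exp_nonneg _)
      (Real.exp_lt_one_iff.2 (by linarith))).mul_left _
  refine Summable.of_nonneg_of_le (fun _ => Real.sqrt_nonneg _) (fun ℓ => ?_) hgeom
  have h1 := (hC ℓ).2.le
  have h2 := (hV ℓ).le
  rw [abs_of_nonneg (h.cost_nonneg ℓ), Real.abs_exp] at h1
  rw [abs_of_nonneg (levelVar_nonneg ℓ), Real.abs_exp] at h2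
  have hexp : Real.exp (γ * ℓ) * Real.exp (-β * ℓ) = (Real.exp (-(β - γ) / 2) ^ ℓ) ^ 2 := by
    rw [← Real.exp_nat_mul, ← Real.exp_nat_mul, ← Real.exp_add]
    congr 1; push_cast; ring
  calc √(C ℓ * levelVar μ Xs ℓ)
      ≤ √((k * Real.exp (γ * ℓ)) * (K * Real.exp (-β * ℓ))) :=
        Real.sqrt_le_sqrt (mul_le_mul h1 h2 (levelVar_nonneg ℓ) ((h.cost_nonneg ℓ).trans h1))
    _ = √(k * K * (Real.exp (-(β - γ) / 2) ^ ℓ) ^ 2) := by rw [← hexp]; ring_nf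
    _ = _ := by rw [Real.sqrt_mul' _ (sq_nonneg _), Real.sqrt_sq (by positivity)]

lemma sqrt_le_sum_sqrt_cost_mul_levelVar (L : ℕ) :
    √(C 0 * levelVar μ Xs 0) ≤ ∑ j ∈ Finset.range (L + 1), √(C j * levelVar μ Xs j) :=
  Finset.single_le_sum (f := fun j => √(C j * levelVar μ Xs j))
    (fun _ _ => Real.sqrt_nonneg _) (by simp)

lemma le_numSamples (ε : ℝ) (ℓ : ℕ) :
    (ε ^ 2)⁻¹ * (√(levelVar μ Xs ℓ / C ℓ) * √(C 0 * levelVar μ Xs 0)) ≤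
      (numSamples μ Xs C α cα ε ℓ : ℝ) := by
  rw [← mul_assoc]
  refine le_trans ?_ ((Nat.le_ceil _).trans (Nat.cast_le.2 (le_max_left _ _)))
  gcongr
  exact sqrt_le_sum_sqrt_cost_mul_levelVar _

/-- The variance of the estimator is at least of the order of the squared tolerance. -/
lemma RateAssumption.exists_mul_sq_le_variance [IsProbabilityMeasure μ]
    (h : RateAssumption μ X Xs C α β γ cα) (hD : IsSampling μ Xs D) (hβγ : γ < β)
    (hV : 0 < levelVar μ Xs 0) :
    ∃ c : ℝ, 0 < c ∧ ∀ ε : ℝ, 0 < ε → ε ≤ 1 →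
      c * ε ^ 2 ≤ variance (estimator μ Xs D C α cα ε) μ := by
  have hS := h.summable_sqrt_cost_mul_levelVar hβγ
  set S := ∑' ℓ, √(C ℓ * levelVar μ Xs ℓ)
  have hS0 : 0 ≤ S := tsum_nonneg fun _ => Real.sqrt_nonneg _
  set B := √(levelVar μ Xs 0 / C 0) * S + 1
  have hB : 0 < B := by positivity
  refine ⟨levelVar μ Xs 0 / B, by positivity, fun ε hε hε1 => ?_⟩
  have hM : (numSamples μ Xs C α cα ε 0 : ℝ) ≤ B / ε ^ 2 := by
    have hsum : ∑ j ∈ Finset.range (numLevels α cα ε + 1), √(C j * levelVar μ Xs j) ≤ S :=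
      hS.sum_le_tsum _ fun _ _ => Real.sqrt_nonneg _
    have hx : (ε ^ 2)⁻¹ * √(levelVar μ Xs 0 / C 0) *
        ∑ j ∈ Finset.range (numLevels α cα ε + 1), √(C j * levelVar μ Xs j) ≤
          (ε ^ 2)⁻¹ * √(levelVar μ Xs 0 / C 0) * S := by gcongr
    have hε2 : 1 ≤ (ε ^ 2)⁻¹ := (one_le_inv₀ (by positivity)).2 (pow_le_one₀ hε.le hε1)
    have hx0 : 0 ≤ (ε ^ 2)⁻¹ * √(levelVar μ Xs 0 / C 0) *
        ∑ j ∈ Finset.range (numLevels α cα ε + 1), √(C j * levelVar μ Xs j) := by positivity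
    have hBeq : B / ε ^ 2 = (ε ^ 2)⁻¹ * √(levelVar μ Xs 0 / C 0) * S + (ε ^ 2)⁻¹ := by
      simp only [B]; field_simp
    rw [numSamples, Nat.cast_max, Nat.cast_one, hBeq]
    refine max_le ?_ ?_
    · linarith [Nat.ceil_lt_add_one hx0]
    · linarith
  have hM0 : (0 : ℝ) < numSamples μ Xs C α cα ε 0 := Nat.cast_pos.2 (numSamples_pos C α cα ε 0)
  rw [hD.variance_estimator h.memLp_level]
  calc levelVar μ Xs 0 / B * ε ^ 2 = levelVar μ Xs 0 / (B / ε ^ 2) := by field_simp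
    _ ≤ levelVar μ Xs 0 / (numSamples μ Xs C α cα ε 0 : ℝ) := by gcongr
    _ ≤ _ := Finset.single_le_sum
        (f := fun ℓ => levelVar μ Xs ℓ / (numSamples μ Xs C α cα ε ℓ : ℝ))
        (fun ℓ _ => div_nonneg (levelVar_nonneg ℓ) (Nat.cast_nonneg _)) (by simp)

/-- The share of level `ℓ` in the variance of the estimator is dominated by a summable sequence,
uniformly in the tolerance. -/
lemma RateAssumption.exists_summable_variance_share_le [IsProbabilityMeasure μ]
    (h : RateAssumption μ X Xs C α β γ cα) (hD : IsSampling μ Xs D) (hβγ : γ < β)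
    (hV : 0 < levelVar μ Xs 0) :
    ∃ b : ℕ → ℝ, Summable b ∧ ∀ ε : ℝ, 0 < ε → ε ≤ 1 →
      0 < variance (estimator μ Xs D C α cα ε) μ ∧ ∀ ℓ, levelVar μ Xs ℓ /
        ((numSamples μ Xs C α cα ε ℓ : ℝ) * variance (estimator μ Xs D C α cα ε) μ) ≤ b ℓ := by
  obtain ⟨c, hc, hvar⟩ := h.exists_mul_sq_le_variance hD hβγ hV
  set s := √(C 0 * levelVar μ Xs 0)
  have hs : 0 < s := Real.sqrt_pos.2 (mul_pos (h.cost_pos 0) hV)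
  refine ⟨fun ℓ => √(C ℓ * levelVar μ Xs ℓ) / (s * c),
    (h.summable_sqrt_cost_mul_levelVar hβγ).div_const _, fun ε hε hε1 => ?_⟩
  have hvar := hvar ε hε hε1
  refine ⟨lt_of_lt_of_le (by positivity) hvar, fun ℓ => ?_⟩
  have hM0 : (0 : ℝ) < numSamples μ Xs C α cα ε ℓ := Nat.cast_pos.2 (numSamples_pos C α cα ε ℓ)
  have hM := le_numSamples (μ := μ) (Xs := Xs) (C := C) (α := α) (cα := cα) ε ℓ
  have hprod : √(C ℓ * levelVar μ Xs ℓ) * √(levelVar μ Xs ℓ / C ℓ) = levelVar μ Xs ℓ := by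
    rw [← Real.sqrt_mul (mul_nonneg (h.cost_nonneg ℓ) (levelVar_nonneg ℓ)),
      show C ℓ * levelVar μ Xs ℓ * (levelVar μ Xs ℓ / C ℓ) = levelVar μ Xs ℓ ^ 2 by
        have := (h.cost_pos ℓ).ne'
        field_simp,
      Real.sqrt_sq (levelVar_nonneg ℓ)]
  rw [inv_mul_le_iff₀ (by positivity)] at hM
  rw [div_le_div_iff₀ (mul_pos hM0 (lt_of_lt_of_le (by positivity) hvar)) (by positivity)]
  calc levelVar μ Xs ℓ * (s * c)
      = √(C ℓ * levelVar μ Xs ℓ) * (√(levelVar μ Xs ℓ / C ℓ) * s) * c := by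
        nth_rewrite 1 [← hprod]; ring
    _ ≤ √(C ℓ * levelVar μ Xs ℓ) * (ε ^ 2 * numSamples μ Xs C α cα ε ℓ) * c := by gcongr
    _ = √(C ℓ * levelVar μ Xs ℓ) * (numSamples μ Xs C α cα ε ℓ * (c * ε ^ 2)) := by ring
    _ ≤ _ := by gcongr

lemma RateAssumption.tendsto_numSamples_atTop (h : RateAssumption μ X Xs C α β γ cα)
    (hV : 0 < levelVar μ Xs 0) {ℓ : ℕ} (hℓ : 0 < levelVar μ Xs ℓ) :
    Tendsto (fun ε => (numSamples μ Xs C α cα ε ℓ : ℝ)) (𝓝[>] 0) atTop := by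
  have hpos : 0 < √(levelVar μ Xs ℓ / C ℓ) * √(C 0 * levelVar μ Xs 0) := by
    have := h.cost_pos 0
    have := h.cost_pos ℓ
    positivity
  refine tendsto_atTop_mono (fun ε => le_numSamples ε ℓ) (Tendsto.atTop_mul_const hpos ?_)
  refine tendsto_inv_nhdsGT_zero.comp (tendsto_nhdsWithin_iff.2 ⟨?_, ?_⟩)
  · exact ((continuous_pow 2).tendsto' (0 : ℝ) 0 (by simp)).mono_left nhdsWithin_le_nhds
  · filter_upwards [self_mem_nhdsWithin] with ε hε using pow_pos (Set.mem_Ioi.1 hε) 2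

lemma eventually_pos_le_one : ∀ᶠ ε in 𝓝[>] (0 : ℝ), 0 < ε ∧ ε ≤ 1 :=
  Ioc_mem_nhdsGT one_pos

lemma RateAssumption.tendsto_sample_variance [IsProbabilityMeasure μ]
    (h : RateAssumption μ X Xs C α β γ cα) (hD : IsSampling μ Xs D) (hβγ : γ < β)
    (hV : 0 < levelVar μ Xs 0) (ℓ : ℕ) :
    Tendsto (fun ε => levelVar μ Xs ℓ / (variance (estimator μ Xs D C α cα ε) μ *
      (numSamples μ Xs C α cα ε ℓ : ℝ) ^ 2)) (𝓝[>] 0) (𝓝 0) := by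
  obtain hℓ | hℓ := (levelVar_nonneg (μ := μ) (Xs := Xs) ℓ).eq_or_lt
  · simp [← hℓ]
  obtain ⟨b, -, hb⟩ := h.exists_summable_variance_share_le hD hβγ hV
  have hlim := (h.tendsto_numSamples_atTop hV hℓ).const_div_atTop (b ℓ)
  refine squeeze_zero' (.of_forall fun ε => ?_) ?_ hlim
  · exact div_nonneg hℓ.le (mul_nonneg (variance_nonneg _ _) (sq_nonneg _))
  · filter_upwards [eventually_pos_le_one] with ε hε
    rw [pow_two, ← mul_assoc, mul_comm (variance _ _), ← div_div]
    gcongr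
    exact (hb ε hε.1 hε.2).2 ℓ

lemma RateAssumption.tendsto_iSup_integral_array_sq [IsProbabilityMeasure μ]
    (h : RateAssumption μ X Xs C α β γ cα) (hD : IsSampling μ Xs D) (hβγ : γ < β)
    (hV : 0 < levelVar μ Xs 0) :
    Tendsto (fun ε => ⨆ m : Fin (totalSamples μ Xs C α cα ε),
      ∫ ω, (array μ Xs D C α cα ε m ω) ^ 2 ∂μ) (𝓝[>] (0 : ℝ)) (𝓝 0) := by
  obtain ⟨b, hbs, hb⟩ := h.exists_summable_variance_share_le hD hβγ hV
  have hnonneg (ε : ℝ) (ℓ : ℕ) : 0 ≤ levelVar μ Xs ℓ /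
      (variance (estimator μ Xs D C α cα ε) μ * (numSamples μ Xs C α cα ε ℓ : ℝ) ^ 2) :=
    div_nonneg (levelVar_nonneg ℓ) (mul_nonneg (variance_nonneg _ _) (sq_nonneg _))
  have hlim := tendsto_sum_range_zero_of_dominated (F := 𝓝[>] (0 : ℝ))
    (fun ε => numLevels α cα ε + 1) hbs ?_ (h.tendsto_sample_variance hD hβγ hV)
  · refine squeeze_zero (fun ε => Real.iSup_nonneg fun m => by positivity) (fun ε => ?_) hlim
    refine Real.iSup_le (fun m => ?_) (Finset.sum_nonneg fun ℓ _ => hnonneg ε ℓ)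
    obtain ⟨ℓ, hℓ, heq⟩ := hD.integral_array_sq C α cα ε h.memLp_level m
    rw [heq]
    exact Finset.single_le_sum (fun ℓ _ => hnonneg ε ℓ) hℓ
  · filter_upwards [eventually_pos_le_one] with ε hε ℓ
    obtain ⟨hvar, hshare⟩ := hb ε hε.1 hε.2
    rw [abs_of_nonneg (hnonneg ε ℓ)]
    refine le_trans ?_ (hshare ℓ)
    have hM : (1 : ℝ) ≤ numSamples μ Xs C α cα ε ℓ :=
      Nat.one_le_cast.2 (numSamples_pos C α cα ε ℓ)
    rw [pow_two, ← mul_assoc, mul_comm (variance _ _)]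
    refine div_le_div_of_nonneg_left (levelVar_nonneg ℓ) (by positivity) ?_
    exact le_mul_of_one_le_right (by positivity) hM

end Rates

section CLT

variable {Ω : Type*} [MeasurableSpace Ω] {μ : Measure Ω} {X : Ω → ℝ} {Xs : ℕ → Ω → ℝ}
  {D : ℕ → ℕ → Ω → ℝ} {C : ℕ → ℝ} {α β γ cα : ℝ}

/-- The centered Gaussian law with the variance of the level difference `Δ_ℓ X`. -/
noncomputable def levelGaussian (μ : Measure Ω) (Xs : ℕ → Ω → ℝ) (ℓ : ℕ) : Measure ℝ :=
  gaussianReal 0 (levelVar μ Xs ℓ).toNNReal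

instance (ℓ : ℕ) : IsProbabilityMeasure (levelGaussian μ Xs ℓ) :=
  inferInstanceAs (IsProbabilityMeasure (gaussianReal _ _))

lemma memLp_id_levelGaussian (ℓ : ℕ) : MemLp id 2 (levelGaussian μ Xs ℓ) :=
  memLp_id_gaussianReal' 2 (by simp)

lemma integral_levelGaussian (ℓ : ℕ) : ∫ x, x ∂levelGaussian μ Xs ℓ = 0 :=
  integral_id_gaussianReal

lemma integral_sq_levelGaussian (ℓ : ℕ) :
    ∫ x, x ^ 2 ∂levelGaussian μ Xs ℓ = levelVar μ Xs ℓ := by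
  have h := variance_fun_id_gaussianReal (μ := 0) (v := (levelVar μ Xs ℓ).toNNReal)
  rwa [variance_of_integral_eq_zero aemeasurable_id' integral_id_gaussianReal,
    Real.coe_toNNReal _ (levelVar_nonneg ℓ)] at h

lemma charFun_levelGaussian (ℓ : ℕ) (t : ℝ) :
    charFun (levelGaussian μ Xs ℓ) t = Complex.exp (-(levelVar μ Xs ℓ * t ^ 2 / 2 : ℝ)) := by
  rw [levelGaussian, charFun_gaussianReal, Real.coe_toNNReal _ (levelVar_nonneg ℓ)]
  simp

/-- The distance at `t` of the characteristic functions of the centered level difference and of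
its Gaussian counterpart. -/
noncomputable def charFunGap (μ : Measure Ω) (Xs : ℕ → Ω → ℝ) (ℓ : ℕ) (t : ℝ) : ℝ :=
  ‖charFun (centeredLaw μ Xs ℓ) t - charFun (levelGaussian μ Xs ℓ) t‖

lemma charFunGap_nonneg (ℓ : ℕ) (t : ℝ) : 0 ≤ charFunGap μ Xs ℓ t := norm_nonneg _

lemma charFunGap_le [IsProbabilityMeasure μ] (hX : ∀ ℓ, MemLp (Xs ℓ) 2 μ) (ℓ : ℕ) (t : ℝ) :
    charFunGap μ Xs ℓ t ≤ 6 * levelVar μ Xs ℓ * t ^ 2 := by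
  have := isProbabilityMeasure_centeredLaw hX ℓ
  have h := norm_charFun_sub_charFun_le (memLp_id_centeredLaw hX ℓ) (integral_centeredLaw hX ℓ)
    (memLp_id_levelGaussian (μ := μ) (Xs := Xs) ℓ) (integral_levelGaussian ℓ)
    (by rw [integral_sq_centeredLaw hX, integral_sq_levelGaussian]) t
  rwa [integral_sq_centeredLaw hX] at h

lemma charFunGap_isLittleO [IsProbabilityMeasure μ] (hX : ∀ ℓ, MemLp (Xs ℓ) 2 μ) (ℓ : ℕ) :
    charFunGap μ Xs ℓ =o[𝓝 0] fun t : ℝ => t ^ 2 := by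
  have := isProbabilityMeasure_centeredLaw hX ℓ
  exact (charFun_sub_charFun_isLittleO (memLp_id_centeredLaw hX ℓ) (integral_centeredLaw hX ℓ)
    (memLp_id_levelGaussian (μ := μ) (Xs := Xs) ℓ) (integral_levelGaussian ℓ)
    (by rw [integral_sq_centeredLaw hX, integral_sq_levelGaussian])).norm_left

/-- A sample of level `ℓ` enters the normalized estimator with the factor `sampleWeight`. -/
noncomputable def sampleWeight (μ : Measure Ω) (Xs : ℕ → Ω → ℝ) (D : ℕ → ℕ → Ω → ℝ) (C : ℕ → ℝ)
    (α cα ε : ℝ) (ℓ : ℕ) : ℝ :=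
  (√(variance (estimator μ Xs D C α cα ε) μ) * (numSamples μ Xs C α cα ε ℓ : ℝ))⁻¹

lemma sampleWeight_mul_sq (ε t : ℝ) (ℓ : ℕ) :
    (sampleWeight μ Xs D C α cα ε ℓ * t) ^ 2 = t ^ 2 /
      (variance (estimator μ Xs D C α cα ε) μ * (numSamples μ Xs C α cα ε ℓ : ℝ) ^ 2) := by
  rw [sampleWeight, mul_pow, inv_pow, mul_pow, Real.sq_sqrt (variance_nonneg _ _)]
  ring

lemma numSamples_mul_levelVar_mul_sq (ε t : ℝ) (ℓ : ℕ) :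
    (numSamples μ Xs C α cα ε ℓ : ℝ) *
      (levelVar μ Xs ℓ * (sampleWeight μ Xs D C α cα ε ℓ * t) ^ 2) =
    t ^ 2 * (levelVar μ Xs ℓ / ((numSamples μ Xs C α cα ε ℓ : ℝ) *
      variance (estimator μ Xs D C α cα ε) μ)) := by
  have hM : (numSamples μ Xs C α cα ε ℓ : ℝ) ≠ 0 :=
    Nat.cast_ne_zero.2 (numSamples_pos C α cα ε ℓ).ne'
  rw [sampleWeight_mul_sq]
  obtain h0 | h0 := eq_or_ne (variance (estimator μ Xs D C α cα ε) μ) 0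
  · simp [h0]
  · field_simp

lemma prod_charFun_levelGaussian [IsProbabilityMeasure μ] (hX : ∀ ℓ, MemLp (Xs ℓ) 2 μ)
    (hD : IsSampling μ Xs D) (ε t : ℝ) (hvar : 0 < variance (estimator μ Xs D C α cα ε) μ) :
    ∏ p ∈ sampleIndices (numLevels α cα ε + 1) (numSamples μ Xs C α cα ε),
      charFun (levelGaussian μ Xs p.1) (sampleWeight μ Xs D C α cα ε p.1 * t) =
    charFun (gaussianReal 0 1) t := by
  have hsum : ∑ p ∈ sampleIndices (numLevels α cα ε + 1) (numSamples μ Xs C α cα ε),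
      levelVar μ Xs p.1 * (sampleWeight μ Xs D C α cα ε p.1 * t) ^ 2 = t ^ 2 := by
    simp only [Finset.sum_sigma, Finset.sum_const, Finset.card_range, nsmul_eq_mul,
      numSamples_mul_levelVar_mul_sq, ← div_div]
    rw [← Finset.mul_sum, ← Finset.sum_div, ← hD.variance_estimator hX, div_self hvar.ne', mul_one]
  simp only [charFun_levelGaussian]
  rw [← Complex.exp_sum, charFun_gaussianReal]
  congr 1
  rw [Finset.sum_neg_distrib, ← Complex.ofReal_sum, ← Finset.sum_div, hsum]
  simp

lemma norm_charFun_sum_array_sub_le [IsProbabilityMeasure μ] (hX : ∀ ℓ, MemLp (Xs ℓ) 2 μ)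
    (hD : IsSampling μ Xs D) (ε t : ℝ) (hvar : 0 < variance (estimator μ Xs D C α cα ε) μ) :
    ‖charFun (μ.map fun ω => ∑ m, array μ Xs D C α cα ε m ω) t - charFun (gaussianReal 0 1) t‖ ≤
      ∑ ℓ ∈ Finset.range (numLevels α cα ε + 1), (numSamples μ Xs C α cα ε ℓ : ℝ) *
        charFunGap μ Xs ℓ (sampleWeight μ Xs D C α cα ε ℓ * t) := by
  have hprob := isProbabilityMeasure_centeredLaw hX
  rw [hD.charFun_sum_array, ← prod_charFun_levelGaussian hX hD ε t hvar]
  refine (norm_prod_sub_prod_le _ _ _ (fun _ _ => norm_charFun_le_one _)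
    fun _ _ => norm_charFun_le_one _).trans_eq ?_
  rw [Finset.sum_sigma]
  simp [charFunGap, sampleWeight]

lemma RateAssumption.tendsto_numSamples_mul_charFunGap [IsProbabilityMeasure μ]
    (h : RateAssumption μ X Xs C α β γ cα) (hD : IsSampling μ Xs D) (hβγ : γ < β)
    (hV : 0 < levelVar μ Xs 0) (t : ℝ) (ℓ : ℕ) :
    Tendsto (fun ε => (numSamples μ Xs C α cα ε ℓ : ℝ) *
      charFunGap μ Xs ℓ (sampleWeight μ Xs D C α cα ε ℓ * t)) (𝓝[>] 0) (𝓝 0) := by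
  obtain hℓ | hℓ := (levelVar_nonneg (μ := μ) (Xs := Xs) ℓ).eq_or_lt
  · have hzero (x : ℝ) : charFunGap μ Xs ℓ x = 0 :=
      le_antisymm (by simpa [← hℓ] using charFunGap_le h.memLp_level ℓ x) (charFunGap_nonneg ℓ x)
    simp [hzero]
  obtain ⟨b, -, hb⟩ := h.exists_summable_variance_share_le hD hβγ hV
  have hw : Tendsto (fun ε => sampleWeight μ Xs D C α cα ε ℓ * t) (𝓝[>] 0) (𝓝 0) := by
    have hsq := (h.tendsto_sample_variance hD hβγ hV ℓ).const_mul (t ^ 2 / levelVar μ Xs ℓ)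
    rw [mul_zero] at hsq
    have hsqrt := hsq.sqrt
    rw [Real.sqrt_zero] at hsqrt
    rw [tendsto_zero_iff_abs_tendsto_zero]
    refine hsqrt.congr fun ε => ?_
    rw [Function.comp_apply, ← Real.sqrt_sq_eq_abs, sampleWeight_mul_sq]
    congr 1
    field_simp
  have hO : (fun ε => (numSamples μ Xs C α cα ε ℓ : ℝ) *
      (sampleWeight μ Xs D C α cα ε ℓ * t) ^ 2) =O[𝓝[>] 0] fun _ => (1 : ℝ) := by
    refine Asymptotics.IsBigO.of_bound (t ^ 2 * b ℓ / levelVar μ Xs ℓ) ?_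
    filter_upwards [eventually_pos_le_one] with ε hε
    rw [Real.norm_of_nonneg (by positivity), norm_one, mul_one, le_div_iff₀ hℓ, mul_assoc,
      mul_comm (_ ^ 2) (levelVar μ Xs ℓ), numSamples_mul_levelVar_mul_sq]
    gcongr
    exact (hb ε hε.1 hε.2).2 ℓ
  refine (Asymptotics.isLittleO_one_iff ℝ).1 (Asymptotics.IsLittleO.trans_isBigO ?_ hO)
  exact (Asymptotics.isBigO_refl _ _).mul_isLittleO
    ((charFunGap_isLittleO h.memLp_level ℓ).comp_tendsto hw)

lemma RateAssumption.tendsto_charFun_sum_array [IsProbabilityMeasure μ]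
    (h : RateAssumption μ X Xs C α β γ cα) (hD : IsSampling μ Xs D) (hβγ : γ < β)
    (hV : 0 < levelVar μ Xs 0) (t : ℝ) :
    Tendsto (fun ε => charFun (μ.map fun ω => ∑ m, array μ Xs D C α cα ε m ω) t) (𝓝[>] 0)
      (𝓝 (charFun (gaussianReal 0 1) t)) := by
  obtain ⟨b, hbs, hb⟩ := h.exists_summable_variance_share_le hD hβγ hV
  rw [tendsto_iff_norm_sub_tendsto_zero]
  have hlim := tendsto_sum_range_zero_of_dominated (F := 𝓝[>] (0 : ℝ))
    (fun ε => numLevels α cα ε + 1) (hbs.mul_left (6 * t ^ 2)) ?_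
    (h.tendsto_numSamples_mul_charFunGap hD hβγ hV t)
  · refine squeeze_zero' (.of_forall fun _ => norm_nonneg _) ?_ hlim
    filter_upwards [eventually_pos_le_one] with ε hε
    exact norm_charFun_sum_array_sub_le h.memLp_level hD ε t (hb ε hε.1 hε.2).1
  · filter_upwards [eventually_pos_le_one] with ε hε ℓ
    rw [abs_of_nonneg (mul_nonneg (Nat.cast_nonneg _) (charFunGap_nonneg ℓ _))]
    calc _ ≤ (numSamples μ Xs C α cα ε ℓ : ℝ) *
          (6 * levelVar μ Xs ℓ * (sampleWeight μ Xs D C α cα ε ℓ * t) ^ 2) := by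
          gcongr
          exact charFunGap_le h.memLp_level ℓ _
      _ = 6 * (t ^ 2 * (levelVar μ Xs ℓ / ((numSamples μ Xs C α cα ε ℓ : ℝ) *
            variance (estimator μ Xs D C α cα ε) μ))) := by
          rw [← numSamples_mul_levelVar_mul_sq (D := D)]; ring
      _ ≤ 6 * (t ^ 2 * b ℓ) := by
          gcongr
          exact (hb ε hε.1 hε.2).2 ℓ
      _ = _ := by ring

end CLT

end MLMC

theorem theorem3 {Ω : Type*} [MeasurableSpace Ω] (μ : Measure Ω) [IsProbabilityMeasure μ]
    (X : Ω → ℝ) (Xs : ℕ → Ω → ℝ) (D : ℕ → ℕ → Ω → ℝ) (C : ℕ → ℝ) (α β γ cα : ℝ)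
    (hrate : MLMC.RateAssumption μ X Xs C α β γ cα)
    (hD : MLMC.IsSampling μ Xs D)
    (hβγ : γ < β)
    (hV : 0 < MLMC.levelVar μ Xs 0) :
    (∀ ε : ℝ, 0 < ε → ∀ ω : Ω,
      MLMC.normalizedEstimator μ Xs D C α cα ε ω = ∑ m, MLMC.array μ Xs D C α cα ε m ω) ∧
    MLMC.ExtendedCLT μ (MLMC.totalSamples μ Xs C α cα) (MLMC.array μ Xs D C α cα) := by
  refine ⟨fun ε _ ω => MLMC.normalizedEstimator_eq_sum_array hrate.memLp_level C α cα ε ω,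
    ⟨hD.aemeasurable_sum_array C α cα, aemeasurable_id, ?_⟩,
    hrate.tendsto_iSup_integral_array_sq hD hβγ hV⟩
  refine tendsto_of_seq_tendsto fun u hu => ?_
  refine ProbabilityMeasure.tendsto_of_tendsto_charFun fun t => ?_
  simp only [Measure.map_id, ProbabilityMeasure.coe_mk]
  exact (hrate.tendsto_charFun_sum_array hD hβγ hV t).comp hu
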